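/- Let $r_n=n+2$ and, for $n\ge 0$, let $$H_n=\{0\}\cup\Big\{m\cdot 5^{\frac{n(n+1)}2}: 1\le m\le\lceil\sqrt n\rceil\Big\}\cup\Big\{5^{\frac{n(n+1)}2+j}:\lceil\sqrt n\rceil\le j\le n\Big\}.$$ Consider the following cutting-and-stacking construction by half-open intervals $(a,b]$. The column $C_0$ is the single level $(0,1]$. Given the column $C_n$, a list of $h_n$ disjoint intervals (levels) of equal width $w_n$ with union $(0,h_nw_n]$, cut each level into $r_n$ intervals of width $w_{n+1}=w_n/r_n$, so that $C_n$ is divided into subcolumns $C_n[0],\dots,C_n[r_n-1]$ from left to right; put $s_{n,k}\ge 0$ new levels (spacers) on top of $C_n[k]$, the spacers being successive intervals of width $w_{n+1}$ to the right of $(0,h_nw_n]$; and stack each subcolumn with its spacers under the next one to obtain $C_{n+1}$. The numbers $s_{n,k}$ are those with $s_{n,0}=0$ for all $n$ and $$\{0\}\cup\Big\{\sum_{k=0}^{i}(h_n+s_{n,k}):0\le i<r_n-1\Big\}=H_n\qquad(n\ge0)$$ (so $h_n=5^{n(n+1)/2}$). Let $T$ be the map that translates every level of every column $C_n$, other than the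 top one, onto the level directly above it. Then such numbers $s_{n,k}$ exist, $T$ is a well-defined invertible transformation of $(0,\infty)$ preserving Lebesgue measure $\mu$, and $T$ is of zero type: $\mu(A\cap T^kA)\to0$ as $k\to\infty$ for every measurable set $A\subset(0,\infty)$ with $\mu(A)<\infty$. -/

import Mathlib

open MeasureTheory Filter Topology

namespace CuttingStacking

/-- A transformation `T` of the measure space `(X, μ)` is of zero type if
`μ (A ∩ T ^ k A) → 0` as `k → ∞`, for every measurable set `A` of finite measure. -/
def IsZeroType {X : Type*} [MeasurableSpace X] (μ : Measure X) (T : X → X) : Prop :=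
  ∀ A : Set X, MeasurableSet A → μ A < ⊤ →
    Tendsto (fun k : ℕ => μ (A ∩ T^[k] '' A)) atTop (𝓝 0)

/-! Cutting and stacking by intervals, starting from the unit interval: the `n`-th column is cut
into `r n` subcolumns and `s n k` spacers are put above the `k`-th of them (`0 ≤ k < r n`). -/

/-- The width of the levels of the `n`-th column: `1 / (r 0 * ⋯ * r (n - 1))`. -/
noncomputable def width (r : ℕ → ℕ) (n : ℕ) : ℝ :=
  (∏ m ∈ Finset.range n, (r m : ℝ))⁻¹

/-- The left endpoints of the levels of the `n`-th column, listed from bottom to top. The column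
`0` consists of the single level `(0, 1]`. A level with left endpoint `a` in column `n` is cut into
the intervals with left endpoints `a + k * width r (n + 1)`, `0 ≤ k < r n`, of width
`width r (n + 1)`. The levels of column `n` fill out an interval with left endpoint `0`, and the
new spacers are successive intervals of width `width r (n + 1)` taken to the right of it. The
subcolumns, each with its spacers on top, are stacked from left to right. -/
noncomputable def column (r : ℕ → ℕ) (s : ℕ → ℕ → ℕ) : ℕ → List ℝ
  | 0 => [0]
  | n + 1 => (List.range (r n)).flatMap fun (k : ℕ) =>
      (column r s n).map (fun (a : ℝ) => a + (k : ℝ) * width r (n + 1)) ++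
      (List.range (s n k)).map (fun (t : ℕ) =>
        ((column r s n).length : ℝ) * width r n
          + (((∑ l ∈ Finset.range k, s n l) + t : ℕ) : ℝ) * width r (n + 1))

/-- The height (number of levels) of the `n`-th column. -/
noncomputable def height (r : ℕ → ℕ) (s : ℕ → ℕ → ℕ) (n : ℕ) : ℕ :=
  (column r s n).length

/-- The left endpoint of the level of index `i < height r s n` in the `n`-th column. -/
noncomputable def left (r : ℕ → ℕ) (s : ℕ → ℕ → ℕ) (n i : ℕ) : ℝ :=
  (column r s n).getD i 0

/-- The level of index `i < height r s n` in the `n`-th column (index `0` is the bottom). -/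
noncomputable def level (r : ℕ → ℕ) (s : ℕ → ℕ → ℕ) (n i : ℕ) : Set ℝ :=
  Set.Ioc (left r s n i) (left r s n i + width r n)

open Classical in
/-- The cutting and stacking transformation: every level of a column, except the top one, is
translated onto the level directly above it. Points that lie in no such level are fixed. -/
noncomputable def transformation (r : ℕ → ℕ) (s : ℕ → ℕ → ℕ) (x : ℝ) : ℝ :=
  if h : ∃ p : ℕ × ℕ, p.2 + 1 < height r s p.1 ∧ x ∈ level r s p.1 p.2 then
    x + (left r s h.choose.1 (h.choose.2 + 1) - left r s h.choose.1 h.choose.2)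
  else x

/-- The height set `H_n = {0} ∪ {∑_{k = 0}^{i} (h_n + s_{n,k}) : 0 ≤ i < r_n - 1}` of a cutting and
stacking construction: the heights in column `n + 1` of the copies of the base of column `n`. -/
def heightSet (r : ℕ → ℕ) (s : ℕ → ℕ → ℕ) (n : ℕ) : Set ℕ :=
  {0} ∪ {x | ∃ i, i + 1 < r n ∧ x = ∑ k ∈ Finset.range (i + 1), (height r s n + s n k)}

/-! The particular construction. -/

/-- Column `n` is cut into `n + 2` subcolumns. -/
def cuts (n : ℕ) : ℕ := n + 2

/-- The number `⌈√n⌉`. -/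
noncomputable def ceilSqrt (n : ℕ) : ℕ := ⌈Real.sqrt (n : ℝ)⌉₊

/-- The exponent `n (n + 1) / 2`. -/
def tri (n : ℕ) : ℕ := n * (n + 1) / 2

/-- The prescribed height set: `0`, the multiples `m * 5 ^ (n (n + 1) / 2)` with `1 ≤ m ≤ ⌈√n⌉`, and
the powers `5 ^ (n (n + 1) / 2 + j)` with `⌈√n⌉ ≤ j ≤ n`. -/
def prescribedHeights (n : ℕ) : Set ℕ :=
  {0} ∪ {x | ∃ m, 1 ≤ m ∧ m ≤ ceilSqrt n ∧ x = m * 5 ^ tri n}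
    ∪ {x | ∃ j, ceilSqrt n ≤ j ∧ j ≤ n ∧ x = 5 ^ (tri n + j)}

/-- The elements of `prescribedHeights n` in increasing order, `0 ≤ j ≤ n + 1`. -/
noncomputable def sortedHeight (n j : ℕ) : ℕ :=
  if j ≤ ceilSqrt n then j * 5 ^ tri n else 5 ^ (tri n + (j - 1))

/-- The numbers of spacers that produce the prescribed height sets with no spacers on the first
subcolumn of any column (the column `n` then has height `5 ^ tri n`). All differences are
nonnegative. The value is used for `0 ≤ k ≤ n + 1` only. -/
noncomputable def spacers (n k : ℕ) : ℕ :=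
  (if k < n + 1 then sortedHeight n (k + 1) else 5 ^ tri (n + 1)) - sortedHeight n k - 5 ^ tri n

/-- The transformation `T` with `n + 2` cuts and the prescribed height sets. -/
noncomputable def T : ℝ → ℝ := transformation cuts spacers

/-- The measure of the space on which `T` acts: Lebesgue measure on `(0, ∞)`. -/
noncomputable def lebesgue : Measure ℝ := volume.restrict (Set.Ioi (0 : ℝ))

end CuttingStacking

namespace CuttingStacking

/-! ### Lists and sums -/

/-! Well-definedness is a matter of copies: column `n` reappears inside every later column as
translated blocks (`exists_copy`), and a point has only one level in a given column
(`level_index_unique`), so any two columns prescribe the same displacement. Here h_n w_n grows at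
least like 2^n, so the columns fill (0, ∞). Every positive point eventually lies above the bottom
level and far below the top (`eventually_mem_inner`), which gives bijectivity and invariance of the
measure.

For zero type it suffices to bound the overlap of X_N, the union of column N, with its preimage
under T^k (`isZeroType_of_exhausting`). In column n > N the levels inside X_N have indices D_n,
where D_{n+1} = D_n + H_n and D_n lies in [0, h_n/4] (`four_mul_indices_le`). Given a large k, take
n with h_n < 4k ≤ h_{n+1}. A coincidence d + x + k = d' + x' with d, d' in D_n and x, x' in H_n puts
x' - x within h_n/4 of k and forces x < x'. Differences are multiples of h_n, so all admissible ones
are equal. Among the powers of 5 a positive difference determines its smaller term, so at most one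
such x lies in the geometric part of H_n. The arithmetic part has only ⌈√n⌉ + 1 terms, 0 included.
Hence at most ⌈√n⌉ + 2 of the n + 2 subcolumns contribute (`card_overlap_succ_le_of_lt`).

In later columns 4k ≤ h forces x = x', so the overlap count grows by at most the number of cuts and
the estimated measure cannot increase (`card_overlap_succ_le_of_le`). The overlap is thus at most
μ(X_N)(⌈√n⌉ + 2)/(n + 2), which tends to 0. -/

theorem length_flatMap_range {α : Type*} (f : ℕ → List α) (r : ℕ) :
    ((List.range r).flatMap f).length = ∑ l ∈ Finset.range r, (f l).length := by
  induction r with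
  | zero => simp
  | succ r ih => simp [List.range_succ, Finset.sum_range_succ, ih]

theorem getElem?_flatMap_range {α : Type*} (f : ℕ → List α) {r k i : ℕ} (hk : k < r)
    (hi : i < (f k).length) :
    ((List.range r).flatMap f)[(∑ l ∈ Finset.range k, (f l).length) + i]? = (f k)[i]? := by
  induction r with
  | zero => omega
  | succ r ih =>
    rw [List.range_succ, List.flatMap_append, List.flatMap_singleton]
    rcases Nat.lt_succ_iff_lt_or_eq.1 hk with h | rfl
    · have := Finset.sum_le_sum_of_subset (f := fun l => (f l).length)
        (Finset.range_mono (Nat.succ_le_of_lt h))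
      rw [Nat.succ_eq_add_one, Finset.sum_range_succ] at this
      rw [List.getElem?_append_left (by rw [length_flatMap_range]; omega), ih h]
    · rw [List.getElem?_append_right (by rw [length_flatMap_range]; omega), length_flatMap_range,
        Nat.add_sub_cancel_left]

theorem exists_eq_sum_range_add (f : ℕ → ℕ) {r j : ℕ} (hj : j < ∑ l ∈ Finset.range r, f l) :
    ∃ k < r, ∃ t < f k, j = (∑ l ∈ Finset.range k, f l) + t := by
  induction r with
  | zero => simp at hj
  | succ r ih =>
    by_cases h : j < ∑ l ∈ Finset.range r, f l
    · obtain ⟨k, hk, t, ht, e⟩ := ih h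
      exact ⟨k, by omega, t, ht, e⟩
    · rw [Finset.sum_range_succ] at hj
      exact ⟨r, by omega, j - ∑ l ∈ Finset.range r, f l, by omega, by omega⟩

theorem exists_nat_mul_lt_le {w y : ℝ} {m : ℕ} (hy : 0 < y) (hm : y ≤ m * w) :
    ∃ a < m, (a : ℝ) * w < y ∧ y ≤ a * w + w := by
  induction m with
  | zero => simp at hm; linarith
  | succ m ih =>
    by_cases h : y ≤ m * w
    · obtain ⟨a, ha, h'⟩ := ih h
      exact ⟨a, by omega, h'⟩
    · push_cast at hm
      exact ⟨m, by omega, not_le.1 h, by linarith⟩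

/-! ### Columns -/

variable {r : ℕ → ℕ} {s : ℕ → ℕ → ℕ}

theorem width_pos (hr : ∀ n, 0 < r n) (n : ℕ) : 0 < width r n :=
  inv_pos.2 (Finset.prod_pos fun m _ => Nat.cast_pos.2 (hr m))

theorem width_eq_mul (hr : ∀ n, 0 < r n) (n : ℕ) : width r n = r n * width r (n + 1) := by
  have h : (r n : ℝ) ≠ 0 := Nat.cast_ne_zero.2 (hr n).ne'
  rw [width, width, Finset.prod_range_succ, mul_inv, mul_comm, mul_assoc, inv_mul_cancel₀ h,
    mul_one]

/-- The index, in column `n + 1`, of the bottom level of the `k`-th subcolumn of column `n`. -/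
noncomputable def offset (r : ℕ → ℕ) (s : ℕ → ℕ → ℕ) (n k : ℕ) : ℕ :=
  ∑ l ∈ Finset.range k, (height r s n + s n l)

theorem height_zero : height r s 0 = 1 := rfl

theorem height_succ (n : ℕ) : height r s (n + 1) = offset r s n (r n) := by
  rw [height, column, length_flatMap_range, offset]
  simp [height]

theorem offset_add_lt {n k i : ℕ} (hk : k < r n) (hi : i < height r s n + s n k) :
    offset r s n k + i < height r s (n + 1) := by
  have := Finset.sum_le_sum_of_subset (f := fun l => height r s n + s n l)
    (Finset.range_mono (Nat.succ_le_of_lt hk))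
  rw [Nat.succ_eq_add_one, Finset.sum_range_succ] at this
  rw [height_succ, offset, offset]
  omega

theorem left_offset_add {n k i : ℕ} (hk : k < r n) (hi : i < height r s n) :
    left r s (n + 1) (offset r s n k + i) = left r s n i + k * width r (n + 1) := by
  have h := getElem?_flatMap_range (fun (k : ℕ) =>
      (column r s n).map (fun (a : ℝ) => a + (k : ℝ) * width r (n + 1)) ++
      (List.range (s n k)).map (fun (t : ℕ) =>
        ((column r s n).length : ℝ) * width r n
          + (((∑ l ∈ Finset.range k, s n l) + t : ℕ) : ℝ) * width r (n + 1))) hk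
      (i := i) (by rw [height] at hi; simp; omega)
  simp only [List.length_append, List.length_map, List.length_range] at h
  rw [left, List.getD_eq_getElem?_getD, column, offset]
  rw [height] at hi ⊢
  rw [h, List.getElem?_append_left (by simpa using hi)]
  simp [left, hi]

theorem height_pos (hr : ∀ n, 0 < r n) (n : ℕ) : 0 < height r s n := by
  induction n with
  | zero => rw [height_zero]; omega
  | succ n ih =>
    have := offset_add_lt (s := s) (i := 0) (hr n) (by omega)
    omega

theorem left_zero (hr : ∀ n, 0 < r n) (n : ℕ) : left r s n 0 = 0 := by
  induction n with
  | zero => simp [left, column]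
  | succ n ih =>
    have := left_offset_add (s := s) (hr n) (height_pos (s := s) hr n)
    simpa [offset, ih] using this

/-- Cutting the `q`-th interval from the left into `r n` pieces yields the grid points `q * r n +
k`, so quotient and remainder recover the old interval and the subcolumn. Grid points beyond those
are spacers. -/
theorem mul_width_mem_column (hr : ∀ n, 0 < r n) (n : ℕ) :
    ∀ j < height r s n, (j : ℝ) * width r n ∈ column r s n := by
  induction n with
  | zero =>
    intro j hj
    rw [height_zero] at hj
    obtain rfl : j = 0 := by omega
    simp [column]
  | succ n ih =>
    intro j hj
    rw [column, List.mem_flatMap]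
    rw [height_succ, offset, Finset.sum_add_distrib, Finset.sum_const, Finset.card_range,
      smul_eq_mul] at hj
    by_cases h : j < r n * height r s n
    · refine ⟨j % r n, List.mem_range.2 (Nat.mod_lt _ (hr n)), List.mem_append_left _
        (List.mem_map.2 ⟨_, ih (j / r n) (Nat.div_lt_of_lt_mul h), ?_⟩)⟩
      rw [width_eq_mul hr n]
      conv_rhs => rw [← Nat.div_add_mod j (r n)]
      push_cast
      ring
    · obtain ⟨k, hk, t, ht, e⟩ := exists_eq_sum_range_add (s n) (r := r n)
        (j := j - r n * height r s n) (by omega)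
      refine ⟨k, List.mem_range.2 hk, List.mem_append_right _
        (List.mem_map.2 ⟨t, List.mem_range.2 ht, ?_⟩)⟩
      rw [← e, Nat.cast_sub (not_lt.1 h), width_eq_mul hr n, ← height]
      push_cast
      ring

theorem column_perm (hr : ∀ n, 0 < r n) (n : ℕ) :
    (List.range (height r s n)).map (fun j : ℕ => (j : ℝ) * width r n) |>.Perm (column r s n) := by
  have hn : ((List.range (height r s n)).map (fun j : ℕ => (j : ℝ) * width r n)).Nodup := by
    refine List.nodup_range.map fun a b h => ?_
    exact Nat.cast_injective (mul_right_cancel₀ (width_pos hr n).ne' h)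
  -- A duplicate-free list contained in a list of the same length is a permutation of it, so only
  -- one inclusion is needed.
  refine (List.subperm_of_subset hn ?_).perm_of_length_le (by simp [height])
  intro x hx
  obtain ⟨j, hj, rfl⟩ := List.mem_map.1 hx
  exact mul_width_mem_column hr n j (List.mem_range.1 hj)

theorem column_nodup (hr : ∀ n, 0 < r n) (n : ℕ) : (column r s n).Nodup := by
  refine (column_perm hr n).nodup_iff.1 (List.nodup_range.map fun a b h => ?_)
  exact Nat.cast_injective (mul_right_cancel₀ (width_pos hr n).ne' h)

theorem left_eq_getElem {n i : ℕ} (hi : i < height r s n) :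
    left r s n i = (column r s n)[i]'hi := by
  exact List.getD_eq_getElem _ _ hi

theorem exists_left_eq_mul (hr : ∀ n, 0 < r n) {n i : ℕ} (hi : i < height r s n) :
    ∃ j < height r s n, left r s n i = j * width r n := by
  have h : left r s n i ∈ column r s n := by
    rw [left_eq_getElem hi]; exact List.getElem_mem _
  obtain ⟨j, hj, e⟩ := List.mem_map.1 ((column_perm hr n).mem_iff.2 h)
  exact ⟨j, List.mem_range.1 hj, e.symm⟩

theorem exists_left_eq (hr : ∀ n, 0 < r n) {n j : ℕ} (hj : j < height r s n) :
    ∃ i < height r s n, left r s n i = j * width r n := by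
  obtain ⟨i, hi, e⟩ := List.mem_iff_getElem.1 (mul_width_mem_column hr n j hj)
  exact ⟨i, hi, by rw [left_eq_getElem hi, e]⟩

theorem level_index_unique (hr : ∀ n, 0 < r n) {n i j : ℕ} (hi : i < height r s n)
    (hj : j < height r s n) {x : ℝ} (hxi : x ∈ level r s n i) (hxj : x ∈ level r s n j) :
    i = j := by
  obtain ⟨a, -, ha⟩ := exists_left_eq_mul hr hi
  obtain ⟨b, -, hb⟩ := exists_left_eq_mul hr hj
  have hw := width_pos hr n
  rw [level, Set.mem_Ioc, ha] at hxi
  rw [level, Set.mem_Ioc, hb] at hxj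
  have h1 : (a : ℝ) < b + 1 := by
    refine lt_of_mul_lt_mul_right ?_ hw.le
    linarith
  have h2 : (b : ℝ) < a + 1 := by
    refine lt_of_mul_lt_mul_right ?_ hw.le
    linarith
  have h3 : a = b := by
    have : a < b + 1 := by exact_mod_cast h1
    have : b < a + 1 := by exact_mod_cast h2
    omega
  rw [← h3, ← ha, left_eq_getElem hi, left_eq_getElem hj] at hb
  exact (List.Nodup.getElem_inj_iff (column_nodup hr n)).1 hb.symm

/-- The part of the space filled by the `n`-th column. -/
def columnUnion (r : ℕ → ℕ) (s : ℕ → ℕ → ℕ) (n : ℕ) : Set ℝ :=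
  Set.Ioc 0 (height r s n * width r n)

theorem exists_mem_level (hr : ∀ n, 0 < r n) {n : ℕ} {x : ℝ} (hx : x ∈ columnUnion r s n) :
    ∃ i < height r s n, x ∈ level r s n i := by
  obtain ⟨a, ha, h1, h2⟩ := exists_nat_mul_lt_le hx.1 hx.2
  obtain ⟨i, hi, e⟩ := exists_left_eq hr ha
  exact ⟨i, hi, by rw [level, e]; exact ⟨h1, h2⟩⟩

theorem level_subset (hr : ∀ n, 0 < r n) {n i : ℕ} (hi : i < height r s n) :
    level r s n i ⊆ columnUnion r s n := by
  obtain ⟨a, ha, e⟩ := exists_left_eq_mul hr hi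
  have hw := width_pos hr n
  rw [level, e]
  refine Set.Ioc_subset_Ioc (by positivity) ?_
  have : (a : ℝ) + 1 ≤ height r s n := by exact_mod_cast ha
  nlinarith

theorem pos_of_mem_level (hr : ∀ n, 0 < r n) {n i : ℕ} (hi : i < height r s n) {x : ℝ}
    (hx : x ∈ level r s n i) : 0 < x :=
  (level_subset hr hi hx).1

theorem exists_mem_level_succ (hr : ∀ n, 0 < r n) {n i : ℕ} (hi : i < height r s n) {x : ℝ}
    (hx : x ∈ level r s n i) :
    ∃ k < r n, x ∈ level r s (n + 1) (offset r s n k + i) := by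
  rw [level, width_eq_mul hr n] at hx
  obtain ⟨k, hk, h1, h2⟩ := exists_nat_mul_lt_le (w := width r (n + 1))
    (y := x - left r s n i) (m := r n) (by linarith [hx.1]) (by linarith [hx.2])
  refine ⟨k, hk, ?_⟩
  rw [level, left_offset_add hk hi]
  constructor <;> linarith

theorem columnUnion_subset_succ (hr : ∀ n, 0 < r n) (n : ℕ) :
    columnUnion r s n ⊆ columnUnion r s (n + 1) := by
  intro x hx
  obtain ⟨i, hi, h⟩ := exists_mem_level hr hx
  obtain ⟨k, hk, h⟩ := exists_mem_level_succ hr hi h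
  exact level_subset hr (offset_add_lt hk (by omega)) h

theorem columnUnion_mono (hr : ∀ n, 0 < r n) : Monotone (columnUnion r s) :=
  monotone_nat_of_le_succ (columnUnion_subset_succ hr)

/-- A point of a level of column `n` lies in a copy of the whole column `n` inside column `m`. -/
theorem exists_copy (hr : ∀ n, 0 < r n) {n m i : ℕ} (hnm : n ≤ m) (hi : i < height r s n) {x : ℝ}
    (hx : x ∈ level r s n i) :
    ∃ (o : ℕ) (d : ℝ), x ∈ level r s m (o + i) ∧
      ∀ j < height r s n, o + j < height r s m ∧ left r s m (o + j) = left r s n j + d := by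
  induction m, hnm using Nat.le_induction with
  | base => exact ⟨0, 0, by simpa using hx, by simp⟩
  | succ m _ ih =>
    obtain ⟨o, d, h1, h2⟩ := ih
    obtain ⟨k, hk, h3⟩ := exists_mem_level_succ hr (h2 i hi).1 h1
    refine ⟨offset r s m k + o, d + k * width r (m + 1), by rwa [add_assoc], fun j hj => ?_⟩
    obtain ⟨h4, h5⟩ := h2 j hj
    rw [add_assoc]
    refine ⟨offset_add_lt hk (by omega), ?_⟩
    rw [left_offset_add hk h4, h5]
    ring

/-! ### The transformation -/

theorem transformation_of_mem_level (hr : ∀ n, 0 < r n) {n i : ℕ} (hi : i + 1 < height r s n)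
    {x : ℝ} (hx : x ∈ level r s n i) :
    transformation r s x = x + (left r s n (i + 1) - left r s n i) := by
  -- The definition uses an arbitrarily chosen column `m` and level `j`. Both columns are compared
  -- inside column `max n m`, where the level of `x` is unique and displacements are those of the
  -- original columns.
  have h : ∃ p : ℕ × ℕ, p.2 + 1 < height r s p.1 ∧ x ∈ level r s p.1 p.2 := ⟨(n, i), hi, hx⟩
  rw [transformation, dif_pos h]
  obtain ⟨hj, hy⟩ := h.choose_spec
  generalize h.choose.1 = m at *
  generalize h.choose.2 = j at *
  obtain ⟨o, d, h1, h2⟩ := exists_copy hr (le_max_left n m) (by omega) hx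
  obtain ⟨o', d', h1', h2'⟩ := exists_copy hr (le_max_right n m) (by omega) hy
  have e := level_index_unique hr (h2 i (by omega)).1 (h2' j (by omega)).1 h1 h1'
  have e1 := (h2 i (by omega)).2
  have e2 := (h2 (i + 1) hi).2
  have e3 := (h2' j (by omega)).2
  have e4 := (h2' (j + 1) hj).2
  rw [← e] at e3
  rw [← add_assoc, ← e] at e4
  rw [← add_assoc] at e2
  linarith

theorem transformation_of_nonpos (hr : ∀ n, 0 < r n) {x : ℝ} (hx : x ≤ 0) :
    transformation r s x = x := by
  rw [transformation, dif_neg]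
  rintro ⟨p, h1, h2⟩
  exact absurd (pos_of_mem_level hr (by omega) h2) (not_lt.2 hx)

theorem transformation_mem_level (hr : ∀ n, 0 < r n) {n i : ℕ} (hi : i + 1 < height r s n)
    {x : ℝ} (hx : x ∈ level r s n i) : transformation r s x ∈ level r s n (i + 1) := by
  rw [transformation_of_mem_level hr hi hx]
  rw [level, Set.mem_Ioc] at hx ⊢
  constructor <;> linarith [hx.1, hx.2]

theorem iterate_transformation_mem_level (hr : ∀ n, 0 < r n) {n i k : ℕ}
    (hi : i + k < height r s n) {x : ℝ} (hx : x ∈ level r s n i) :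
    (transformation r s)^[k] x ∈ level r s n (i + k) := by
  induction k with
  | zero => simpa using hx
  | succ k ih =>
    rw [Function.iterate_succ_apply', ← add_assoc]
    exact transformation_mem_level hr (by omega) (ih (by omega))

/-- The points that lie in a level of column `n` with at least `k` levels above it and at least one
level below it. -/
def inner (r : ℕ → ℕ) (s : ℕ → ℕ → ℕ) (n k : ℕ) : Set ℝ :=
  {x | ∃ i, 0 < i ∧ i + k < height r s n ∧ x ∈ level r s n i}

theorem bijOn_transformation (hr : ∀ n, 0 < r n)
    (h : ∀ x, 0 < x → ∀ k, ∀ᶠ n in atTop, x ∈ inner r s n k) :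
    Set.BijOn (transformation r s) (Set.Ioi 0) (Set.Ioi 0) := by
  refine ⟨fun x hx => ?_, fun x hx y hy e => ?_, fun y hy => ?_⟩
  · obtain ⟨n, i, -, hi, hxi⟩ := (h x hx 1).exists
    exact pos_of_mem_level hr hi (transformation_mem_level hr hi hxi)
  · obtain ⟨n, ⟨i, -, hi, hxi⟩, ⟨j, -, hj, hyj⟩⟩ := ((h x hx 1).and (h y hy 1)).exists
    have h1 := transformation_mem_level hr hi hxi
    rw [e] at h1
    have h2 := level_index_unique hr hi hj h1 (transformation_mem_level hr hj hyj)
    obtain rfl : i = j := by omega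
    rw [transformation_of_mem_level hr hi hxi, transformation_of_mem_level hr hi hyj] at e
    linarith
  · obtain ⟨n, i, h0, hi, hyi⟩ := (h y hy 0).exists
    obtain ⟨j, rfl⟩ : ∃ j, i = j + 1 := ⟨i - 1, by omega⟩
    have hm : y - (left r s n (j + 1) - left r s n j) ∈ level r s n j := by
      rw [level, Set.mem_Ioc] at hyi ⊢
      constructor <;> linarith [hyi.1, hyi.2]
    refine ⟨_, pos_of_mem_level hr (by omega) hm, ?_⟩
    rw [transformation_of_mem_level hr hi hm]
    ring

/-- Injectivity on all of ℝ, where the nonpositive points are fixed, makes the iterates measurable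
embeddings of ℝ. -/
theorem injective_transformation (hr : ∀ n, 0 < r n)
    (h : ∀ x, 0 < x → ∀ k, ∀ᶠ n in atTop, x ∈ inner r s n k) :
    Function.Injective (transformation r s) := by
  have hb := bijOn_transformation hr h
  intro x y e
  rcases lt_or_ge 0 x with hx | hx <;> rcases lt_or_ge 0 y with hy | hy
  · exact hb.injOn hx hy e
  · have := hb.mapsTo hx
    rw [e, transformation_of_nonpos hr hy] at this
    exact absurd this (not_lt.2 hy)
  · have := hb.mapsTo hy
    rw [← e, transformation_of_nonpos hr hx] at this
    exact absurd this (not_lt.2 hx)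
  · rwa [transformation_of_nonpos hr hx, transformation_of_nonpos hr hy] at e

/-! ### Measurability and invariance of Lebesgue measure. -/

theorem measurableSet_level (n i : ℕ) : MeasurableSet (level r s n i) := measurableSet_Ioc

theorem preimage_transformation_inter_level (hr : ∀ n, 0 < r n) {n i : ℕ}
    (hi : i + 1 < height r s n) (A : Set ℝ) :
    transformation r s ⁻¹' A ∩ level r s n i =
      (fun x => x + (left r s n (i + 1) - left r s n i)) ⁻¹' (A ∩ level r s n (i + 1)) := by
  have hl : ∀ x, x + (left r s n (i + 1) - left r s n i) ∈ level r s n (i + 1) ↔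
      x ∈ level r s n i := by
    intro x
    rw [level, level, Set.mem_Ioc, Set.mem_Ioc]
    constructor <;> rintro ⟨h1, h2⟩ <;> constructor <;> linarith
  ext x
  simp only [Set.mem_inter_iff, Set.mem_preimage, hl]
  refine and_congr_left fun hx => ?_
  rw [transformation_of_mem_level hr hi hx]

theorem measurable_transformation (hr : ∀ n, 0 < r n)
    (h : ∀ x, 0 < x → ∀ k, ∀ᶠ n in atTop, x ∈ inner r s n k) :
    Measurable (transformation r s) := by
  intro A hA
  have e : transformation r s ⁻¹' A = (Set.Iic 0 ∩ A) ∪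
      ⋃ (n : ℕ) (i : ℕ) (_ : i + 1 < height r s n), transformation r s ⁻¹' A ∩ level r s n i := by
    ext x
    simp only [Set.mem_union, Set.mem_iUnion, Set.mem_inter_iff, Set.mem_preimage, Set.mem_Iic]
    constructor
    · intro hx
      rcases lt_or_ge 0 x with h0 | h0
      · obtain ⟨n, i, -, hi, hxi⟩ := (h x h0 1).exists
        exact Or.inr ⟨n, i, hi, hx, hxi⟩
      · rw [transformation_of_nonpos hr h0] at hx
        exact Or.inl ⟨h0, hx⟩
    · rintro (⟨h0, hx⟩ | ⟨n, i, hi, hx, hxi⟩)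
      · rwa [transformation_of_nonpos hr h0]
      · exact hx
  rw [e]
  refine (measurableSet_Iic.inter hA).union
    (MeasurableSet.iUnion fun n => MeasurableSet.iUnion fun i => MeasurableSet.iUnion fun hi => ?_)
  rw [preimage_transformation_inter_level hr hi]
  exact (measurable_add_const _) (hA.inter (measurableSet_level _ _))

theorem measurePreserving_transformation (hr : ∀ n, 0 < r n)
    (h : ∀ x, 0 < x → ∀ k, ∀ᶠ n in atTop, x ∈ inner r s n k) :
    MeasurePreserving (transformation r s) lebesgue lebesgue := by
  have hm := measurable_transformation hr h
  refine ⟨hm, Measure.ext fun A hA => ?_⟩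
  rw [Measure.map_apply hm hA, lebesgue, Measure.restrict_apply (hm hA), Measure.restrict_apply hA]
  -- `P n` collects the levels below the top and `Q n` those above the bottom. The map carries `P n`
  -- to `Q n` by translations of levels, and both families increase to (0, ∞).
  set P : ℕ → Set ℝ := fun n => ⋃ i ∈ Finset.range (height r s n - 1), level r s n i with hP
  set Q : ℕ → Set ℝ := fun n => ⋃ i ∈ Finset.range (height r s n - 1), level r s n (i + 1) with hQ
  have memP : ∀ n x, x ∈ P n ↔ ∃ i, i + 1 < height r s n ∧ x ∈ level r s n i := by
    intro n x
    simp only [hP, Set.mem_iUnion, Finset.mem_range, exists_prop, Nat.lt_sub_iff_add_lt]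
  have memQ : ∀ n x, x ∈ Q n ↔ ∃ i, i + 1 < height r s n ∧ x ∈ level r s n (i + 1) := by
    intro n x
    simp only [hQ, Set.mem_iUnion, Finset.mem_range, exists_prop, Nat.lt_sub_iff_add_lt]
  have monoP : Monotone P := by
    intro n m hnm x hx
    obtain ⟨i, hi, hxi⟩ := (memP n x).1 hx
    obtain ⟨o, d, h1, h2⟩ := exists_copy hr hnm (by omega) hxi
    exact (memP m x).2 ⟨o + i, (h2 (i + 1) hi).1, h1⟩
  have monoQ : Monotone Q := by
    intro n m hnm x hx
    obtain ⟨i, hi, hxi⟩ := (memQ n x).1 hx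
    obtain ⟨o, d, h1, h2⟩ := exists_copy hr hnm hi hxi
    exact (memQ m x).2 ⟨o + i, (h2 (i + 1) hi).1, h1⟩
  have unionP : ⋃ n, P n = Set.Ioi 0 := by
    ext x
    rw [Set.mem_iUnion]
    constructor
    · rintro ⟨n, hx⟩
      obtain ⟨i, hi, hxi⟩ := (memP n x).1 hx
      exact pos_of_mem_level hr (by omega) hxi
    · intro hx
      obtain ⟨n, i, -, hi, hxi⟩ := (h x hx 1).exists
      exact ⟨n, (memP n x).2 ⟨i, hi, hxi⟩⟩
  have unionQ : ⋃ n, Q n = Set.Ioi 0 := by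
    ext x
    rw [Set.mem_iUnion]
    constructor
    · rintro ⟨n, hx⟩
      obtain ⟨i, hi, hxi⟩ := (memQ n x).1 hx
      exact pos_of_mem_level hr hi hxi
    · intro hx
      obtain ⟨n, i, h0, hi, hxi⟩ := (h x hx 0).exists
      obtain ⟨j, rfl⟩ : ∃ j, i = j + 1 := ⟨i - 1, by omega⟩
      exact ⟨n, (memQ n x).2 ⟨j, hi, hxi⟩⟩
  have key : ∀ n, volume (transformation r s ⁻¹' A ∩ P n) = volume (A ∩ Q n) := by
    intro n
    rw [hP, hQ]
    simp only [Set.inter_iUnion]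
    rw [measure_biUnion_finset, measure_biUnion_finset]
    · refine Finset.sum_congr rfl fun i hi => ?_
      rw [Finset.mem_range] at hi
      rw [preimage_transformation_inter_level hr (by omega), measure_preimage_add_right]
    · intro i hi j hj hij
      simp only [Finset.coe_range, Set.mem_Iio] at hi hj
      refine Set.disjoint_left.2 fun x hx hx' => hij ?_
      have := level_index_unique hr (by omega) (by omega) hx.2 hx'.2
      omega
    · exact fun i _ => hA.inter (measurableSet_level _ _)
    · intro i hi j hj hij
      simp only [Finset.coe_range, Set.mem_Iio] at hi hj
      exact Set.disjoint_left.2 fun x hx hx' =>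
        hij (level_index_unique hr (by omega) (by omega) hx.2 hx'.2)
    · exact fun i _ => (hm hA).inter (measurableSet_level _ _)
  rw [← unionP]
  conv_rhs => rw [unionP, ← unionQ]
  rw [Set.inter_iUnion, Set.inter_iUnion,
    Monotone.measure_iUnion fun n m hnm => Set.inter_subset_inter_right _ (monoP hnm),
    Monotone.measure_iUnion fun n m hnm => Set.inter_subset_inter_right _ (monoQ hnm)]
  exact iSup_congr key

/-- A measure preserving injection of a standard space is of zero type if the self-overlaps of the
sets of an exhausting sequence tend to zero. -/
theorem isZeroType_of_exhausting (hr : ∀ n, 0 < r n)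
    (h : ∀ x, 0 < x → ∀ k, ∀ᶠ n in atTop, x ∈ inner r s n k)
    (hz : ∀ N, Tendsto (fun k : ℕ => volume
      (columnUnion r s N ∩ (transformation r s)^[k] ⁻¹' columnUnion r s N)) atTop (𝓝 0)) :
    IsZeroType lebesgue (transformation r s) := by
  intro A hA hfin
  have hm := measurable_transformation hr h
  have hp := measurePreserving_transformation hr h
  have hi := injective_transformation hr h
  have e : ∀ k, lebesgue (A ∩ (transformation r s)^[k] '' A) =
      -- By injectivity, the preimage of `A ∩ T^[k] '' A` under `T^[k]` is `T^[k] ⁻¹' A ∩ A`.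
      lebesgue (A ∩ (transformation r s)^[k] ⁻¹' A) := by
    intro k
    have hk := (hp.iterate k).measure_preimage_emb
      ((hm.iterate k).measurableEmbedding (hi.iterate k)) (A ∩ (transformation r s)^[k] '' A)
    rw [← hk, Set.preimage_inter, Set.preimage_image_eq _ (hi.iterate k), Set.inter_comm]
  simp only [e]
  have hX : ∀ N, MeasurableSet (columnUnion r s N) := fun N => measurableSet_Ioc
  have htail : Tendsto (fun N => lebesgue (A \ columnUnion r s N)) atTop (𝓝 0) := by
    have := tendsto_measure_iInter_atTop (μ := lebesgue) (s := fun N => A \ columnUnion r s N)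
      (fun N => (hA.diff (hX N)).nullMeasurableSet)
      (fun n m hnm => Set.sdiff_subset_sdiff_right (columnUnion_mono hr hnm))
      ⟨0, ((measure_mono Set.sdiff_subset).trans_lt hfin).ne⟩
    have hnull : lebesgue (⋂ N, A \ columnUnion r s N) = 0 := by
      refine measure_mono_null (t := Set.Iic 0) (fun x hx => ?_) ?_
      · by_contra h0
        obtain ⟨n, i, -, hi, hxi⟩ := (h x (not_le.1 h0) 0).exists
        exact (Set.mem_iInter.1 hx n).2 (level_subset hr hi hxi)
      · rw [lebesgue, Measure.restrict_apply measurableSet_Iic, Set.inter_comm, Set.Ioi_inter_Iic]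
        simp
    rwa [hnull] at this
  rw [ENNReal.tendsto_nhds_zero] at htail ⊢
  intro ε hε
  have hε3 : 0 < ε / 3 := ENNReal.div_pos hε.ne' (by simp)
  obtain ⟨N, hN⟩ := (htail _ hε3).exists
  filter_upwards [(ENNReal.tendsto_nhds_zero.1 (hz N)) _ hε3] with k hk
  have hsub : A ∩ (transformation r s)^[k] ⁻¹' A ⊆
      ((A \ columnUnion r s N) ∪ (transformation r s)^[k] ⁻¹' (A \ columnUnion r s N)) ∪
        (columnUnion r s N ∩ (transformation r s)^[k] ⁻¹' columnUnion r s N) := by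
    rintro x ⟨h1, h2⟩
    by_cases h3 : x ∈ columnUnion r s N
    · by_cases h4 : (transformation r s)^[k] x ∈ columnUnion r s N
      · exact Or.inr ⟨h3, h4⟩
      · exact Or.inl (Or.inr ⟨h2, h4⟩)
    · exact Or.inl (Or.inl ⟨h1, h3⟩)
  calc lebesgue (A ∩ (transformation r s)^[k] ⁻¹' A)
      ≤ lebesgue (A \ columnUnion r s N) +
          lebesgue ((transformation r s)^[k] ⁻¹' (A \ columnUnion r s N)) +
        lebesgue (columnUnion r s N ∩ (transformation r s)^[k] ⁻¹' columnUnion r s N) :=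
        (measure_mono hsub).trans ((measure_union_le _ _).trans
          (add_le_add_left (measure_union_le _ _) _))
    _ ≤ ε / 3 + ε / 3 + ε / 3 := by
        rw [(hp.iterate k).measure_preimage (hA.diff (hX N)).nullMeasurableSet]
        gcongr
        exact (Measure.restrict_apply_le _ _).trans hk
    _ = ε := ENNReal.add_thirds ε

/-! ### The prescribed heights -/

theorem cuts_pos (n : ℕ) : 0 < cuts n := Nat.succ_pos _

theorem ceilSqrt_le (n : ℕ) : ceilSqrt n ≤ n := by
  refine Nat.ceil_le.2 (Real.sqrt_le_iff.2 ⟨n.cast_nonneg, ?_⟩)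
  have : n ≤ n ^ 2 := Nat.le_self_pow two_ne_zero n
  exact_mod_cast this

theorem tri_succ (n : ℕ) : tri (n + 1) = tri n + (n + 1) := by
  rw [tri, tri, show (n + 1) * (n + 1 + 1) = n * (n + 1) + (n + 1) * 2 by ring,
    Nat.add_mul_div_right _ _ two_pos]

/-- The prescribed heights in units of `5 ^ tri n`. -/
noncomputable def heightRatio (n j : ℕ) : ℕ :=
  if j ≤ ceilSqrt n then j else 5 ^ (j - 1)

theorem sortedHeight_eq (n j : ℕ) : sortedHeight n j = heightRatio n j * 5 ^ tri n := by
  rw [sortedHeight, heightRatio]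
  split_ifs
  · rfl
  · rw [pow_add, mul_comm]

theorem heightRatio_of_lt {n j : ℕ} (h : ceilSqrt n < j) : heightRatio n j = 5 ^ (j - 1) :=
  if_neg (not_le.2 h)

theorem succ_le_five_pow (n : ℕ) : n + 1 ≤ 5 ^ n := Nat.lt_pow_self (by norm_num)

/-- Successive prescribed heights differ by at least one column height, so the truncated
subtractions in `spacers` are exact. At the passage from multiples to powers this is j + 1 ≤ 5^j. -/
theorem heightRatio_add_one_le (n j : ℕ) : heightRatio n j + 1 ≤ heightRatio n (j + 1) := by
  rw [heightRatio, heightRatio]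
  split_ifs with h1 h2 h2
  · omega
  · exact succ_le_five_pow j
  · omega
  · obtain ⟨i, rfl⟩ : ∃ i, j = i + 1 := ⟨j - 1, by omega⟩
    have := Nat.pow_pos (n := i) (show 0 < 5 by norm_num)
    simp only [Nat.add_sub_cancel, pow_succ]
    omega

theorem heightRatio_strictMono (n : ℕ) : StrictMono (heightRatio n) :=
  strictMono_nat_of_lt_succ (heightRatio_add_one_le n)

theorem heightRatio_last (n : ℕ) : heightRatio n (n + 1) = 5 ^ n :=
  heightRatio_of_lt (Nat.lt_succ_of_le (ceilSqrt_le n))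

theorem heightRatio_le {n j : ℕ} (hj : j < n + 2) : heightRatio n j ≤ 5 ^ n :=
  heightRatio_last n ▸ (heightRatio_strictMono n).monotone (by omega)

theorem sortedHeight_add_spacers {n k : ℕ} (hk : k < n + 1) :
    sortedHeight n k + (5 ^ tri n + spacers n k) = sortedHeight n (k + 1) := by
  have h := Nat.mul_le_mul_right (5 ^ tri n) (heightRatio_add_one_le n k)
  rw [add_mul, one_mul, ← sortedHeight_eq, ← sortedHeight_eq] at h
  rw [spacers, if_pos hk]
  omega

theorem sortedHeight_last_add_spacers (n : ℕ) :
    sortedHeight n (n + 1) + (5 ^ tri n + spacers n (n + 1)) = 5 ^ tri (n + 1) := by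
  have h : (5 ^ n + 1) * 5 ^ tri n ≤ 5 ^ tri (n + 1) := by
    rw [tri_succ, pow_add, mul_comm]
    refine Nat.mul_le_mul_left _ ?_
    have := Nat.pow_pos (n := n) (show 0 < 5 by norm_num)
    rw [pow_succ]
    omega
  rw [add_mul, one_mul, ← heightRatio_last, ← sortedHeight_eq] at h
  rw [spacers, if_neg (lt_irrefl _)]
  omega

theorem sortedHeight_zero (n : ℕ) : sortedHeight n 0 = 0 := by simp [sortedHeight]

theorem spacers_zero (n : ℕ) : spacers n 0 = 0 := by
  have h : sortedHeight n 1 = 5 ^ tri n := by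
    rw [sortedHeight]
    split_ifs with h
    · exact one_mul _
    · rfl
  rw [spacers, if_pos n.succ_pos, h, sortedHeight_zero, Nat.sub_zero, Nat.sub_self]

/-- The sum telescopes. The height is a hypothesis because `height_eq` is itself proved by induction
from this. -/
theorem offset_eq_of_height {n : ℕ} (h : height cuts spacers n = 5 ^ tri n) {k : ℕ}
    (hk : k < n + 2) : offset cuts spacers n k = sortedHeight n k := by
  induction k with
  | zero => rw [sortedHeight_zero, offset, Finset.sum_range_zero]
  | succ k ih =>
    rw [offset, Finset.sum_range_succ, ← offset, ih (by omega), h,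
      sortedHeight_add_spacers (by omega)]

theorem height_eq (n : ℕ) : height cuts spacers n = 5 ^ tri n := by
  induction n with
  | zero => rfl
  | succ n ih =>
    rw [height_succ, cuts, offset, Finset.sum_range_succ, ← offset,
      offset_eq_of_height ih (by omega), ih, sortedHeight_last_add_spacers]

theorem offset_eq {n k : ℕ} (hk : k < n + 2) : offset cuts spacers n k = sortedHeight n k :=
  offset_eq_of_height (height_eq n) hk

theorem heightSet_eq (n : ℕ) : heightSet cuts spacers n = prescribedHeights n := by
  have h : ∀ i, i + 1 < n + 2 → ∑ k ∈ Finset.range (i + 1), (height cuts spacers n + spacers n k) =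
      sortedHeight n (i + 1) := fun i hi => offset_eq hi
  have hc := ceilSqrt_le n
  ext x
  simp only [heightSet, prescribedHeights, cuts, Set.mem_union, Set.mem_singleton_iff,
    Set.mem_ofPred_eq, or_assoc]
  refine or_congr_right ⟨?_, ?_⟩
  · rintro ⟨i, hi, rfl⟩
    rw [h i hi, sortedHeight]
    split_ifs with h1
    · exact Or.inl ⟨i + 1, by omega, h1, rfl⟩
    · exact Or.inr ⟨i, by omega, by omega, rfl⟩
  · rintro (⟨m, hm, hm', rfl⟩ | ⟨j, hj, hj', rfl⟩)
    · obtain ⟨i, rfl⟩ : ∃ i, m = i + 1 := ⟨m - 1, by omega⟩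
      exact ⟨i, by omega, by rw [h i (by omega), sortedHeight, if_pos hm']⟩
    · exact ⟨j, by omega, by rw [h j (by omega), sortedHeight, if_neg (by omega),
        Nat.add_sub_cancel]⟩

/-! ### Exhaustion of the half-line -/

theorem width_succ_le (n : ℕ) : width cuts (n + 1) ≤ 1 / 2 * width cuts n := by
  have h := width_pos cuts_pos (n + 1)
  rw [width_eq_mul cuts_pos n, cuts]
  push_cast
  nlinarith [n.cast_nonneg (α := ℝ)]

theorem width_le (n : ℕ) : width cuts n ≤ (1 / 2) ^ n := by
  induction n with
  | zero => simp [width]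
  | succ n ih =>
    rw [pow_succ']
    linarith [width_succ_le n]

theorem two_pow_le_height_mul_width (n : ℕ) :
    2 ^ n ≤ (height cuts spacers n : ℝ) * width cuts n := by
  induction n with
  | zero => simp [width, height_zero]
  | succ n ih =>
    have h5 : 2 * (n + 2) ≤ 5 ^ (n + 1) := by
      have := succ_le_five_pow n
      rw [pow_succ]
      omega
    have h5 : 2 * ((n : ℝ) + 2) ≤ 5 ^ (n + 1) := by exact_mod_cast h5
    have hw := width_pos cuts_pos (n + 1)
    rw [height_eq, width_eq_mul cuts_pos n, cuts] at ih
    rw [height_eq, tri_succ, pow_succ]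
    push_cast at ih ⊢
    rw [pow_add]
    calc (2 : ℝ) ^ n * 2 ≤ (5 ^ tri n * ((n + 2) * width cuts (n + 1))) * 2 := by gcongr
      _ = 5 ^ tri n * (2 * (n + 2)) * width cuts (n + 1) := by ring
      _ ≤ 5 ^ tri n * 5 ^ (n + 1) * width cuts (n + 1) := by gcongr

theorem eventually_mem_columnUnion {x : ℝ} (hx : 0 < x) :
    ∀ᶠ n in atTop, x ∈ columnUnion cuts spacers n := by
  filter_upwards [(tendsto_pow_atTop_atTop_of_one_lt (one_lt_two (α := ℝ))).eventually_ge_atTop x]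
    with n hn
  exact ⟨hx, hn.trans (two_pow_le_height_mul_width n)⟩

theorem exists_mem_level_of_mem_columnUnion {n : ℕ} {x : ℝ}
    (hx : x ∈ columnUnion cuts spacers n) {i : ℕ} (hi : i < height cuts spacers (n + 1))
    (hxi : x ∈ level cuts spacers (n + 1) i) :
    ∃ j < height cuts spacers n, x ∈ level cuts spacers n j ∧
      ∃ k < n + 2, i = j + sortedHeight n k := by
  obtain ⟨j, hj, hxj⟩ := exists_mem_level cuts_pos hx
  obtain ⟨k, hk, hxk⟩ := exists_mem_level_succ cuts_pos hj hxj
  refine ⟨j, hj, hxj, k, hk, ?_⟩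
  rw [← offset_eq hk, add_comm]
  exact level_index_unique cuts_pos hi (offset_add_lt hk (by omega)) hxi hxk

/-- Each of the three summands is at most 5^n h_n, while h_{n+1} = 5 · 5^n h_n. This leaves room
above every copy of column `n`. -/
theorem add_sortedHeight_add_lt {n j k : ℕ} (hj : j < height cuts spacers n) (hk : k < n + 2) :
    j + sortedHeight n k + n < height cuts spacers (n + 1) := by
  have h1 : sortedHeight n k ≤ 5 ^ n * 5 ^ tri n := by
    rw [sortedHeight_eq]
    exact Nat.mul_le_mul_right _ (heightRatio_le hk)
  have h2 : height cuts spacers (n + 1) = 5 * (5 ^ n * 5 ^ tri n) := by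
    rw [height_eq, tri_succ, pow_add, pow_succ]
    ring
  have h3 : n + 1 ≤ 5 ^ n * 5 ^ tri n :=
    (succ_le_five_pow n).trans (Nat.le_mul_of_pos_right _ (Nat.pow_pos (by norm_num)))
  have h4 : 5 ^ tri n ≤ 5 ^ n * 5 ^ tri n :=
    Nat.le_mul_of_pos_left _ (Nat.pow_pos (by norm_num))
  rw [height_eq] at hj
  omega

theorem eventually_mem_inner (x : ℝ) (hx : 0 < x) (k : ℕ) :
    ∀ᶠ n in atTop, x ∈ inner cuts spacers n k := by
  -- The room above `x` is visible only one column after `x` has appeared. The bottom level is (0,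
  -- w], and it misses `x` once w < x.
  rw [← map_add_atTop_eq_nat 1, eventually_map]
  have hw : ∀ᶠ n in atTop, width cuts (n + 1) < x := by
    have h0 := (tendsto_pow_atTop_nhds_zero_of_lt_one (r := (1 / 2 : ℝ)) (by norm_num)
      (by norm_num)).comp (tendsto_add_atTop_nat 1)
    filter_upwards [h0.eventually_lt_const hx] with n hn
    exact (width_le _).trans_lt hn
  filter_upwards [eventually_mem_columnUnion hx, hw, eventually_ge_atTop k] with n hn hwn hk
  obtain ⟨i, hi, hxi⟩ := exists_mem_level cuts_pos (columnUnion_subset_succ cuts_pos n hn)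
  obtain ⟨j, hj, -, l, hl, rfl⟩ := exists_mem_level_of_mem_columnUnion hn hi hxi
  have := add_sortedHeight_add_lt hj hl
  refine ⟨_, Nat.pos_of_ne_zero fun h0 => ?_, by omega, hxi⟩
  rw [h0, level, left_zero cuts_pos] at hxi
  linarith [hxi.2]

/-! ### Overlaps -/

/-- The indices of the levels of column `N + m` that are contained in column `N`. -/
noncomputable def indices (N : ℕ) : ℕ → Finset ℕ
  | 0 => Finset.range (5 ^ tri N)
  | m + 1 => Finset.image₂ (fun d j => d + sortedHeight (N + m) j) (indices N m)
      (Finset.range (N + m + 2))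

/-- The indices of the levels of column `N + m` that, together with the level `k` steps higher, are
contained in column `N`. -/
noncomputable def overlap (N m k : ℕ) : Finset ℕ :=
  (indices N m).filter fun d => d + k ∈ indices N m

theorem mem_indices {N m : ℕ} {x : ℝ} (hx : x ∈ columnUnion cuts spacers N) {i : ℕ}
    (hi : i < height cuts spacers (N + m)) (hxi : x ∈ level cuts spacers (N + m) i) :
    i ∈ indices N m := by
  induction m generalizing i with
  | zero => exact Finset.mem_range.2 (height_eq N ▸ hi)
  | succ m ih =>
    obtain ⟨j, hj, hxj, k, hk, rfl⟩ := exists_mem_level_of_mem_columnUnion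
      (columnUnion_mono cuts_pos (Nat.le_add_right N m) hx) hi hxi
    exact Finset.mem_image₂_of_mem (ih hj hxj) (Finset.mem_range.2 hk)

theorem card_indices_succ_le (N m : ℕ) :
    (indices N (m + 1)).card ≤ (N + m + 2) * (indices N m).card := by
  refine (Finset.card_image₂_le _ _ _).trans ?_
  rw [Finset.card_range, mul_comm]

theorem card_indices_mul_width_le (N m : ℕ) :
    ((indices N m).card : ℝ) * width cuts (N + m) ≤ 5 ^ tri N * width cuts N := by
  induction m with
  | zero => simp [indices]
  | succ m ih =>
    refine le_trans ?_ ih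
    rw [width_eq_mul cuts_pos (N + m), cuts, ← add_assoc, ← mul_assoc]
    refine mul_le_mul_of_nonneg_right ?_ (width_pos cuts_pos _).le
    rw [mul_comm]
    exact_mod_cast card_indices_succ_le N m

/-- For n ≥ 1, d < h_n ≤ 5^n h_n / 5, so d plus a height is below (6/5) 5^n h_n, and 4 · 6/5 < 5.
For n = 0 this estimate fails, but then the column is a single level and d = 0. The starting column
`m = 0` is excluded, as its indices fill the whole range. -/
theorem four_mul_indices_le (N m : ℕ) : ∀ d ∈ indices N (m + 1), 4 * d ≤ 5 ^ tri (N + m + 1) := by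
  have step : ∀ m, ∀ d, d < 5 ^ tri (N + m) → (N + m = 0 → d = 0) →
      ∀ j < N + m + 2,
      4 * (d + sortedHeight (N + m) j) ≤ 5 ^ tri (N + m + 1) := by
    intro m d hd h0 j hj
    generalize N + m = n at *
    have h1 : sortedHeight n j ≤ 5 ^ n * 5 ^ tri n := by
      rw [sortedHeight_eq]
      exact Nat.mul_le_mul_right _ (heightRatio_le hj)
    rw [tri_succ, pow_add, pow_succ]
    rcases Nat.eq_zero_or_pos n with rfl | hn
    · have := h0 rfl
      subst this
      simp at h1 ⊢
      omega
    · have h2 : 5 * 5 ^ tri n ≤ 5 ^ n * 5 ^ tri n :=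
        Nat.mul_le_mul_right _ (Nat.le_self_pow hn.ne' 5)
      have h3 : 5 ^ tri n * (5 ^ n * 5) = 5 * (5 ^ n * 5 ^ tri n) := by ring
      omega
  induction m with
  | zero =>
    intro d hd
    obtain ⟨a, ha, j, hj, rfl⟩ := Finset.mem_image₂.1 hd
    have ha := Finset.mem_range.1 ha
    refine step 0 a ha (fun h => ?_) j (Finset.mem_range.1 hj)
    obtain rfl : N = 0 := by omega
    simp [tri] at ha
    exact ha
  | succ m ih =>
    intro d hd
    obtain ⟨a, ha, j, hj, rfl⟩ := Finset.mem_image₂.1 hd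
    have ha := ih a ha
    have := Nat.pow_pos (n := tri (N + m + 1)) (show 0 < 5 by norm_num)
    exact step (m + 1) a (by rw [← add_assoc]; omega) (by omega) j
      (Finset.mem_range.1 hj)

/-- If d + x + k = d' + x', then x' - x = d + k - d' is a multiple of h between -h/4 and h/2, hence
zero. A coincidence thus already occurs within a single copy of the preceding column. -/
theorem card_overlap_succ_le_of_le {N m k : ℕ} (hm : 1 ≤ m) (hk : 4 * k ≤ 5 ^ tri (N + m)) :
    (overlap N (m + 1) k).card ≤ (N + m + 2) * (overlap N m k).card := by
  obtain ⟨m, rfl⟩ : ∃ l, m = l + 1 := ⟨m - 1, by omega⟩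
  have hsub : overlap N (m + 1 + 1) k ⊆ Finset.image₂
      (fun d j => d + sortedHeight (N + (m + 1)) j) (overlap N (m + 1) k)
      (Finset.range (N + (m + 1) + 2)) := by
    intro e he
    obtain ⟨h1, h2⟩ := Finset.mem_filter.1 he
    obtain ⟨d, hd, j, hj, rfl⟩ := Finset.mem_image₂.1 h1
    obtain ⟨d', hd', j', hj', e⟩ := Finset.mem_image₂.1 h2
    refine Finset.mem_image₂_of_mem (Finset.mem_filter.2 ⟨hd, ?_⟩) hj
    have b := four_mul_indices_le N m d hd
    have b' := four_mul_indices_le N m d' hd'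
    simp only [sortedHeight_eq] at e
    rw [← add_assoc] at hk
    simp only [← add_assoc] at e
    have hpos := Nat.pow_pos (n := tri (N + m + 1)) (show 0 < 5 by norm_num)
    generalize 5 ^ tri (N + m + 1) = h at *
    have hjj : heightRatio (N + m + 1) j = heightRatio (N + m + 1) j' := by
      rcases lt_trichotomy (heightRatio (N + m + 1) j) (heightRatio (N + m + 1) j') with l | l | l
      · have := Nat.mul_le_mul_right h l
        rw [Nat.succ_mul] at this
        omega
      · exact l
      · have := Nat.mul_le_mul_right h l
        rw [Nat.succ_mul] at this
        omega
    rw [hjj] at e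
    obtain rfl : d' = d + k := by omega
    exact hd'
  refine (Finset.card_le_card hsub).trans ((Finset.card_image₂_le _ _ _).trans ?_)
  rw [Finset.card_range, mul_comm]

/-- If b < d, then 5^d - 5^c ≥ 4 · 5^(d-1) exceeds 5^b, so equal differences have equal larger
terms. -/
theorem five_pow_sub_injective {a b c d : ℕ} (hab : a < b) (hcd : c < d)
    (h : 5 ^ b + 5 ^ c = 5 ^ d + 5 ^ a) : a = c := by
  have lt_of_lt : ∀ {a b c d : ℕ}, c < d → b < d → 5 ^ b + 5 ^ c < 5 ^ d + 5 ^ a := by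
    intro a b c d hcd hbd
    obtain ⟨e, rfl⟩ : ∃ e, d = e + 1 := ⟨d - 1, by omega⟩
    have h1 := Nat.pow_le_pow_right (show 0 < 5 by norm_num) (show b ≤ e by omega)
    have h2 := Nat.pow_le_pow_right (show 0 < 5 by norm_num) (show c ≤ e by omega)
    have h3 := Nat.pow_pos (n := e) (show 0 < 5 by norm_num)
    rw [pow_succ]
    generalize 5 ^ a = A at *
    generalize 5 ^ b = B at *
    generalize 5 ^ c = C at *
    omega
  rcases lt_trichotomy b d with l | rfl | l
  · exact absurd h (lt_of_lt hcd l).ne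
  · exact Nat.pow_right_injective (by norm_num : 2 ≤ 5) (Nat.add_left_cancel h).symm
  · exact absurd h (lt_of_lt hab l).ne'

theorem card_overlap_succ_le_of_lt {N m k : ℕ} (hm : 1 ≤ m) (hk : 5 ^ tri (N + m) < 4 * k) :
    (overlap N (m + 1) k).card ≤ (ceilSqrt (N + m) + 2) * (indices N m).card := by
  classical
  obtain ⟨m, rfl⟩ : ∃ l, m = l + 1 := ⟨m - 1, by omega⟩
  rw [← add_assoc] at hk ⊢
  set n := N + m + 1 with hn
  set h := 5 ^ tri n with hh
  have hpos : 0 < h := Nat.pow_pos (by norm_num)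
  -- `J` holds the subcolumns from which a shift by `k`, up to an error h/4, reaches a higher one.
  set J := (Finset.range (n + 2)).filter fun j => ∃ j', j < j' ∧
    4 * (heightRatio n j' * h) ≤ 4 * (heightRatio n j * h + k) + h ∧
    4 * (heightRatio n j * h + k) ≤ 4 * (heightRatio n j' * h) + h with hJ
  have hsub : overlap N (m + 1 + 1) k ⊆ Finset.image₂
      (fun d j => d + sortedHeight n j) (indices N (m + 1)) J := by
    intro e he
    obtain ⟨h1, h2⟩ := Finset.mem_filter.1 he
    obtain ⟨d, hd, j, hj, rfl⟩ := Finset.mem_image₂.1 h1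
    obtain ⟨d', hd', j', hj', e⟩ := Finset.mem_image₂.1 h2
    have b := four_mul_indices_le N m d hd
    have b' := four_mul_indices_le N m d' hd'
    simp only [sortedHeight_eq] at e
    simp only [← add_assoc, ← hn, ← hh] at e b b' hj
    refine Finset.mem_image₂_of_mem hd (Finset.mem_filter.2 ⟨hj, j', ?_, by omega, by omega⟩)
    -- The inequality `j < j'` comes from d' ≤ h/4 < k.
    refine (heightRatio_strictMono n).lt_iff_lt.1 (lt_of_mul_lt_mul_right (a := h) ?_ h.zero_le)
    omega
  have hJcard : J.card ≤ ceilSqrt n + 2 := by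
    have hsplit : J ⊆ Finset.range (ceilSqrt n + 1) ∪ J.filter fun j => ceilSqrt n < j := by
      intro j hj
      rw [Finset.mem_union, Finset.mem_range, Finset.mem_filter]
      by_cases l : ceilSqrt n < j
      · exact Or.inr ⟨hj, l⟩
      · exact Or.inl (by omega)
    have hone : (J.filter fun j => ceilSqrt n < j).card ≤ 1 := by
      refine Finset.card_le_one.2 fun a ha b hb => ?_
      obtain ⟨ha, ca⟩ := Finset.mem_filter.1 ha
      obtain ⟨hb, cb⟩ := Finset.mem_filter.1 hb
      obtain ⟨-, a', laa, a1, a2⟩ := Finset.mem_filter.1 ha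
      obtain ⟨-, b', lbb, b1, b2⟩ := Finset.mem_filter.1 hb
      rw [heightRatio_of_lt ca, heightRatio_of_lt (ca.trans laa)] at a1 a2
      rw [heightRatio_of_lt cb, heightRatio_of_lt (cb.trans lbb)] at b1 b2
      -- Two multiples of h, each within h/4 of `k`, differ by at most h/2 and so coincide.
      have key : 5 ^ (a' - 1) + 5 ^ (b - 1) = 5 ^ (b' - 1) + 5 ^ (a - 1) := by
        generalize 5 ^ (a' - 1) = A' at *
        generalize 5 ^ (a - 1) = A at *
        generalize 5 ^ (b' - 1) = B' at *
        generalize 5 ^ (b - 1) = B at *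
        rcases lt_trichotomy (A' + B) (B' + A) with l | l | l
        · have := Nat.mul_le_mul_right h l
          rw [Nat.succ_mul, add_mul, add_mul] at this
          omega
        · exact l
        · have := Nat.mul_le_mul_right h l
          rw [Nat.succ_mul, add_mul, add_mul] at this
          omega
      have := five_pow_sub_injective (by omega) (by omega) key
      omega
    refine (Finset.card_le_card hsplit).trans ((Finset.card_union_le _ _).trans ?_)
    rw [Finset.card_range]
    omega
  refine (Finset.card_le_card hsub).trans ((Finset.card_image₂_le _ _ _).trans ?_)
  rw [mul_comm]
  exact Nat.mul_le_mul_right _ hJcard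

theorem card_overlap_mul_width_le {N m k : ℕ} (hm : 1 ≤ m) (hk : 5 ^ tri (N + m) < 4 * k)
    (hk' : 4 * k ≤ 5 ^ tri (N + m + 1)) (l : ℕ) :
    ((overlap N (m + 1 + l) k).card : ℝ) * width cuts (N + (m + 1 + l)) ≤
      5 ^ tri N * width cuts N * ((ceilSqrt (N + m) + 2) / ((N + m : ℕ) + 2)) := by
  induction l with
  | zero =>
    have h1 : ((overlap N (m + 1) k).card : ℝ) ≤
        (ceilSqrt (N + m) + 2) * (indices N m).card := by
      exact_mod_cast card_overlap_succ_le_of_lt hm hk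
    have h2 := card_indices_mul_width_le N m
    have h3 : width cuts (N + (m + 1)) = width cuts (N + m) / ((N + m : ℕ) + 2) := by
      rw [width_eq_mul cuts_pos (N + m), cuts, ← add_assoc]
      push_cast
      field_simp
    have hw := width_pos cuts_pos (N + m)
    rw [add_zero, h3]
    calc ((overlap N (m + 1) k).card : ℝ) * (width cuts (N + m) / ((N + m : ℕ) + 2))
        ≤ ((ceilSqrt (N + m) + 2) * (indices N m).card) *
          (width cuts (N + m) / ((N + m : ℕ) + 2)) := by gcongr
      _ = (indices N m).card * width cuts (N + m) *
          ((ceilSqrt (N + m) + 2) / ((N + m : ℕ) + 2)) := by ring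
      _ ≤ _ := by gcongr
  | succ l ih =>
    refine le_trans ?_ ih
    have hmono : 5 ^ tri (N + m + 1) ≤ 5 ^ tri (N + (m + 1 + l)) := by
      refine Nat.pow_le_pow_right (by norm_num) (monotone_nat_of_le_succ (fun n => ?_) (by omega))
      rw [tri_succ]
      omega
    have h1 := card_overlap_succ_le_of_le (N := N) (m := m + 1 + l) (by omega) (hk'.trans hmono)
    rw [width_eq_mul cuts_pos (N + (m + 1 + l)), cuts, ← mul_assoc]
    refine mul_le_mul_of_nonneg_right ?_ (width_pos cuts_pos _).le
    rw [mul_comm]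
    exact_mod_cast h1

/-! ### From counts of levels to measure. -/

/-- In column `N + m`, `overlap` sees only points with `k` levels above them. These sets increase
with `m` and exhaust the overlap, so a bound for all large `m` passes to the limit. -/
theorem measure_overlap_le {N M k : ℕ} {b : ℝ} (h : ∀ m, M ≤ m →
      ((overlap N m k).card : ℝ) * width cuts (N + m) ≤ b) :
    volume (columnUnion cuts spacers N ∩
      (transformation cuts spacers)^[k] ⁻¹' columnUnion cuts spacers N) ≤ ENNReal.ofReal b := by
  set E := columnUnion cuts spacers N ∩
      (transformation cuts spacers)^[k] ⁻¹' columnUnion cuts spacers N with hE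
  have hmono : Monotone fun m => E ∩ inner cuts spacers (N + (M + m)) k := by
    rintro m m' hmm x ⟨hx, i, h0, hi, hxi⟩
    obtain ⟨o, d, h1, h2⟩ := exists_copy cuts_pos (show N + (M + m) ≤ N + (M + m') by omega)
      (by omega) hxi
    exact ⟨hx, o + i, by omega, by have := (h2 (i + k) hi).1; omega, h1⟩
  have hunion : E ⊆ ⋃ m, E ∩ inner cuts spacers (N + (M + m)) k := by
    intro x hx
    obtain ⟨n, hn⟩ := eventually_atTop.1 (eventually_mem_inner x hx.1.1 k)
    exact Set.mem_iUnion.2 ⟨n, hx, hn _ (by omega)⟩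
  refine (measure_mono hunion).trans ?_
  rw [hmono.measure_iUnion]
  refine iSup_le fun m => ?_
  have hsub : E ∩ inner cuts spacers (N + (M + m)) k ⊆
      ⋃ i ∈ overlap N (M + m) k, level cuts spacers (N + (M + m)) i := by
    rintro x ⟨⟨hx1, hx2⟩, i, h0, hi, hxi⟩
    refine Set.mem_biUnion (Finset.mem_filter.2 ⟨mem_indices hx1 (by omega) hxi, ?_⟩) hxi
    exact mem_indices hx2 hi (iterate_transformation_mem_level cuts_pos hi hxi)
  refine (measure_mono hsub).trans ((measure_biUnion_finset_le _ _).trans ?_)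
  simp only [level, Real.volume_Ioc, add_sub_cancel_left, Finset.sum_const, nsmul_eq_mul]
  rw [← ENNReal.ofReal_natCast, ← ENNReal.ofReal_mul (Nat.cast_nonneg _)]
  exact ENNReal.ofReal_le_ofReal (h _ (by omega))

theorem tendsto_ceilSqrt_div :
    Tendsto (fun n : ℕ => ((ceilSqrt n : ℝ) + 2) / ((n : ℝ) + 2)) atTop (𝓝 0) := by
  -- For n ≥ 1, ⌈√n⌉ + 2 ≤ √n + 3 ≤ 4√n.
  have h0 : Tendsto (fun n : ℕ => 4 / √(n : ℝ)) atTop (𝓝 0) :=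
    tendsto_const_nhds.div_atTop (Real.tendsto_sqrt_atTop.comp tendsto_natCast_atTop_atTop)
  refine squeeze_zero' (Eventually.of_forall fun n => by positivity) ?_ h0
  filter_upwards [eventually_ge_atTop 1] with n hn
  have h1 : 1 ≤ √(n : ℝ) := Real.one_le_sqrt.2 (by exact_mod_cast hn)
  have h2 : (ceilSqrt n : ℝ) < √(n : ℝ) + 1 := Nat.ceil_lt_add_one (Real.sqrt_nonneg _)
  have h3 : √(n : ℝ) * √(n : ℝ) = n := Real.mul_self_sqrt n.cast_nonneg
  rw [div_le_div_iff₀ (by positivity) (by positivity)]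
  nlinarith

theorem tendsto_measure_overlap (N : ℕ) : Tendsto (fun k : ℕ => volume
    (columnUnion cuts spacers N ∩
      (transformation cuts spacers)^[k] ⁻¹' columnUnion cuts spacers N)) atTop (𝓝 0) := by
  have hb := (tendsto_ceilSqrt_div.const_mul (5 ^ tri N * width cuts N))
  rw [mul_zero] at hb
  have hb := ENNReal.tendsto_ofReal hb
  rw [ENNReal.ofReal_zero, ENNReal.tendsto_nhds_zero] at hb
  rw [ENNReal.tendsto_nhds_zero]
  intro ε hε
  obtain ⟨P, hP⟩ := eventually_atTop.1 (hb ε hε)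
  filter_upwards [eventually_gt_atTop (5 ^ tri (N + (P + 1)))] with k hk
  have hex : ∃ m, 4 * k ≤ 5 ^ tri (N + (P + 1) + m) := by
    refine ⟨4 * k, (Nat.le_of_lt (Nat.lt_pow_self (show 1 < 5 by norm_num))).trans
      (Nat.pow_le_pow_right (by norm_num) ?_)⟩
    have : ∀ n, n ≤ tri n := by
      intro n
      cases n with
      | zero => exact Nat.zero_le _
      | succ n => rw [tri_succ]; omega
    have := this (N + (P + 1) + 4 * k)
    omega
  obtain ⟨h1, h2⟩ : 4 * k ≤ 5 ^ tri (N + (P + 1) + Nat.find hex) ∧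
      ∀ m < Nat.find hex, ¬ 4 * k ≤ 5 ^ tri (N + (P + 1) + m) :=
    ⟨Nat.find_spec hex, fun m hm => Nat.find_min hex hm⟩
  generalize Nat.find hex = q at h1 h2
  -- The minimal `q` is positive because `k` exceeds the height of column `N + (P + 1)`; its
  -- predecessor gives the column with h_n < 4k ≤ h_{n+1}.
  obtain ⟨p, rfl⟩ : ∃ p, q = p + 1 := by
    refine ⟨q - 1, ?_⟩
    rcases Nat.eq_zero_or_pos q with rfl | hq
    · rw [add_zero] at h1
      omega
    · omega
  have h3 := not_le.1 (h2 p (by omega))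
  rw [add_assoc N] at h3
  rw [← add_assoc, add_assoc N] at h1
  refine (measure_overlap_le (M := P + 1 + p + 1) fun m hm => ?_).trans
    (hP (N + (P + 1 + p)) (by omega))
  obtain ⟨l, rfl⟩ := Nat.exists_eq_add_of_le hm
  exact card_overlap_mul_width_le (by omega) h3 h1 l

end CuttingStacking

theorem mainTheorem10 :
    -- the construction has no spacers on first subcolumns and the prescribed height sets
    (∀ n : ℕ, CuttingStacking.spacers n 0 = 0) ∧
    (∀ n : ℕ, CuttingStacking.heightSet CuttingStacking.cuts CuttingStacking.spacers n =
      CuttingStacking.prescribedHeights n) ∧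
    -- `T` is well defined: in every column it translates each level below the top onto the next one
    (∀ n i : ℕ, i + 1 < CuttingStacking.height CuttingStacking.cuts CuttingStacking.spacers n →
      ∀ x ∈ CuttingStacking.level CuttingStacking.cuts CuttingStacking.spacers n i,
        CuttingStacking.T x = x +
          (CuttingStacking.left CuttingStacking.cuts CuttingStacking.spacers n (i + 1) -
            CuttingStacking.left CuttingStacking.cuts CuttingStacking.spacers n i)) ∧
    -- `T` is an invertible measure-preserving transformation of `(0, ∞)`
    Set.BijOn CuttingStacking.T (Set.Ioi 0) (Set.Ioi 0) ∧
    MeasurePreserving CuttingStacking.T CuttingStacking.lebesgue CuttingStacking.lebesgue ∧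
    -- `T` is of zero type
    CuttingStacking.IsZeroType CuttingStacking.lebesgue CuttingStacking.T := by
  open CuttingStacking in
  exact ⟨spacers_zero, heightSet_eq,
    fun n i hi x hx => transformation_of_mem_level cuts_pos hi hx,
    bijOn_transformation cuts_pos eventually_mem_inner,
    measurePreserving_transformation cuts_pos eventually_mem_inner,
    isZeroType_of_exhausting cuts_pos eventually_mem_inner tendsto_measure_overlap⟩
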